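/- Let $X$ be a real Banach space with dual $X^*$, and let $X\oplus X^*$ carry any of the usual (equivalent) direct sum norms. A continuous quadratic form on a Banach space $E$ is a function $q:E\to\mathbb R$ of the form $q(x)=b(x,x)$ with $b$ a continuous bilinear form on $E$. It is delta-semidefinite if it is a difference of two nonnegative continuous quadratic forms on $E$, and delta-convex if it is a difference of two continuous convex functions on $E$. The space $E$ satisfies (D) (respectively (dc)) if each continuous quadratic form on $E$ is delta-semidefinite (respectively delta-convex). An $E$-valued Walsh-Paley martingale is a sequence $(f_0,\dots,f_n)$ of functions $\{-1,1\}^n\to E$ such that $f_k$ depends only on the first $k$ coordinates for $0\le k\le n$, and $f_k(\omega)=\frac12 f_{k+1}(\omega,-1)+\frac12 f_{k+1}(\omega,1)$ for $0\le k<n$ and $\omega\in\{-1,1\}^k$. The space $E$ is a UMD-space if there is a constant $C>0$ such that $$\mathbb E\Big\|\sum_{k=1}^n\varepsilon_k(f_k-f_{k-1})\Big\|^2\le C\,\mathbb E\|f_n\|^2$$ for all $n$, all $E$-valued Walsh-Paley martingales $(f_0,\dots,f_n)$ and all $\varepsilon_1,\dots,\varepsilon_n\in\{-1,1\}$, where $\mathbb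 E$ is the expectation for the uniform probability on $\{-1,1\}^n$. **Proposition 3.8.** The function $Q(x,x^*)=x^*(x)$ is a continuous quadratic form on $X\oplus X^*$. The following three assertions are equivalent: (i) $X\oplus X^*$ satisfies (D); (ii) $Q$ is delta-semidefinite; (iii) $X$ is isomorphic (linearly homeomorphic) to a Hilbert space. Also, the following three assertions are equivalent: (i') $X\oplus X^*$ satisfies (dc); (ii') $Q$ is delta-convex; (iii') $X$ is a UMD-space. -/

import Mathlib

noncomputable section

universe u v

/-- `q` is a continuous (purely) quadratic form: `q x = b x x` for some continuous bilinear
form `b`. -/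
def IsContQuadForm {E : Type u} [NormedAddCommGroup E] [NormedSpace ℝ E] (q : E → ℝ) : Prop :=
  ∃ b : E →L[ℝ] E →L[ℝ] ℝ, ∀ x, q x = b x x

/-- `q` is the difference of two nonnegative continuous quadratic forms. -/
def IsDeltaSemidefinite {E : Type u} [NormedAddCommGroup E] [NormedSpace ℝ E]
    (q : E → ℝ) : Prop :=
  ∃ p₁ p₂ : E → ℝ, IsContQuadForm p₁ ∧ IsContQuadForm p₂ ∧
    (∀ x, 0 ≤ p₁ x) ∧ (∀ x, 0 ≤ p₂ x) ∧ ∀ x, q x = p₁ x - p₂ x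

/-- `φ` is the difference of two continuous convex functions. -/
def IsDeltaConvex {E : Type u} [NormedAddCommGroup E] [NormedSpace ℝ E] (φ : E → ℝ) : Prop :=
  ∃ g₁ g₂ : E → ℝ, Continuous g₁ ∧ Continuous g₂ ∧
    ConvexOn ℝ Set.univ g₁ ∧ ConvexOn ℝ Set.univ g₂ ∧ ∀ x, φ x = g₁ x - g₂ x

/-- Property (D): each continuous quadratic form on `E` is delta-semidefinite. -/
def PropertyD (E : Type u) [NormedAddCommGroup E] [NormedSpace ℝ E] : Prop :=
  ∀ q : E → ℝ, IsContQuadForm q → IsDeltaSemidefinite q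

/-- Property (dc): each continuous quadratic form on `E` is delta-convex. -/
def PropertyDC (E : Type u) [NormedAddCommGroup E] [NormedSpace ℝ E] : Prop :=
  ∀ q : E → ℝ, IsContQuadForm q → IsDeltaConvex q

/-- Expectation of a real function on `{-1, 1}ⁿ` for the uniform probability measure
(`ℤˣ` is the two-point set `{-1, 1}`). -/
def signExpectation {n : ℕ} (g : (Fin n → ℤˣ) → ℝ) : ℝ :=
  ((2 : ℝ) ^ n)⁻¹ * ∑ ω, g ω

/-- `(f 0, …, f n)` is a Walsh-Paley martingale on `{-1, 1}ⁿ`: `f k` depends only on the first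
`k` coordinates, and `f k` is the average of `f (k + 1)` over the two signs of the next
coordinate. (Coordinates are numbered from `0` to `n - 1`.) -/
structure IsWalshPaleyMartingale {E : Type u} [NormedAddCommGroup E] [NormedSpace ℝ E] {n : ℕ}
    (f : Fin (n + 1) → (Fin n → ℤˣ) → E) : Prop where
  adapted : ∀ (k : Fin (n + 1)) (ω ω' : Fin n → ℤˣ),
    (∀ i : Fin n, (i : ℕ) < (k : ℕ) → ω i = ω' i) → f k ω = f k ω'
  average : ∀ (k : Fin n) (ω : Fin n → ℤˣ),
    f k.castSucc ω = (1 / 2 : ℝ) • f k.succ (Function.update ω k (-1))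
      + (1 / 2 : ℝ) • f k.succ (Function.update ω k 1)

/-- `T` is a UMD-operator: `𝔼 ‖∑ₖ εₖ T(dfₖ)‖² ≤ C 𝔼 ‖fₙ‖²` for all Walsh-Paley martingales and
all choices of signs, with one constant `C`. -/
def IsUMDOperator {E : Type u} {F : Type v} [NormedAddCommGroup E] [NormedSpace ℝ E]
    [NormedAddCommGroup F] [NormedSpace ℝ F] (T : E →ₗ[ℝ] F) : Prop :=
  ∃ C : ℝ, 0 < C ∧ ∀ (n : ℕ) (f : Fin (n + 1) → (Fin n → ℤˣ) → E),
    IsWalshPaleyMartingale f → ∀ ε : Fin n → ℤˣ,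
      signExpectation
          (fun ω => ‖∑ k : Fin n, ((ε k : ℤ) : ℝ) • T (f k.succ ω - f k.castSucc ω)‖ ^ 2)
        ≤ C * signExpectation (fun ω => ‖f (Fin.last n) ω‖ ^ 2)

/-- `E` is a UMD-space: its identity is a UMD-operator. -/
def IsUMDSpace (E : Type u) [NormedAddCommGroup E] [NormedSpace ℝ E] : Prop :=
  IsUMDOperator (LinearMap.id : E →ₗ[ℝ] E)

/-- `E` is linearly homeomorphic to a real Hilbert space (which may be taken in the same universe,
since it is in bijection with `E`). -/
def IsIsomorphicToHilbert (E : Type u) [NormedAddCommGroup E] [NormedSpace ℝ E] : Prop :=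
  ∃ (H : Type u) (_ : NormedAddCommGroup H) (_ : InnerProductSpace ℝ H),
    CompleteSpace H ∧ Nonempty (E ≃L[ℝ] H)

/-- The form `Q (x, x*) = x* x` on `X ⊕ X*`. All the usual norms on the direct sum are equivalent
to the maximum norm of the product. -/
def pairingForm (X : Type u) [NormedAddCommGroup X] [NormedSpace ℝ X] :
    X × StrongDual ℝ X → ℝ :=
  fun z => z.2 z.1

end

/-! Call `q` controlled if some `Ψ` with `0 ≤ Ψ ≤ C‖·‖²` has second differences at least `|q d|`.
For a continuous quadratic form, control is equivalent to delta-convexity. Given control, `(Ψ ± q) /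
2` are convex, continuous by their quadratic bound, and differ by `q`. Conversely, the sum of the
two convex functions gives control near 0, and rescaled copies are pieced together into a function
of quadratic growth.

Control is tied to UMD through martingales. Along a martingale `Ψ` telescopes, so `𝔼 ∑ |q (dfₖ)| ≤ C
𝔼 ‖fₙ‖²`. For the pairing form, pair `f` with a martingale in the dual whose last value norms the
transform of `f`: this is the UMD inequality. Conversely, UMD passes from `X` to `X*` and to `X ⊕
X*`, and on a UMD-space every continuous quadratic form is controlled by a Burkholder function, an
infimum over the martingales that start at a given point.

For (D): if `Q = p₁ - p₂` with `pᵢ ≥ 0`, then Cauchy-Schwarz for each `pᵢ` at `(x, 0)` and `(0, φ)`,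
where `φ` norms `x`, shows that `p₁ + p₂` restricted to `X` is the square of an equivalent Hilbert
norm. Conversely, if `X` is Hilbertian then so is `X ⊕ X*`, and there every continuous quadratic
form is dominated by a multiple of the squared norm. -/

noncomputable section

/-! ### Delta-convexity and control by a function of quadratic growth. -/

section Control

variable {E : Type u} [NormedAddCommGroup E] [NormedSpace ℝ E]

/-- `q` is dominated by the second differences of a nonnegative function of quadratic growth. -/
def HasQuadraticControl (q : E → ℝ) : Prop :=
  ∃ (C : ℝ) (Ψ : E → ℝ), (∀ x, 0 ≤ Ψ x) ∧ (∀ x, Ψ x ≤ C * ‖x‖ ^ 2) ∧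
    ∀ x d, Ψ x + |q d| ≤ (Ψ (x + d) + Ψ (x - d)) / 2

lemma IsContQuadForm.parallelogram {q : E → ℝ} (hq : IsContQuadForm q) (x d : E) :
    (q (x + d) + q (x - d)) / 2 = q x + q d := by
  obtain ⟨b, hb⟩ := hq
  simp only [hb, map_add, map_sub, add_apply, sub_apply]
  ring

lemma IsContQuadForm.map_smul {q : E → ℝ} (hq : IsContQuadForm q) (t : ℝ) (x : E) :
    q (t • x) = t ^ 2 * q x := by
  obtain ⟨b, hb⟩ := hq
  simp only [hb, _root_.map_smul, smul_apply, smul_eq_mul]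
  ring

lemma IsContQuadForm.exists_abs_le {q : E → ℝ} (hq : IsContQuadForm q) :
    ∃ K : ℝ, 0 ≤ K ∧ ∀ x, |q x| ≤ K * ‖x‖ ^ 2 := by
  obtain ⟨b, hb⟩ := hq
  refine ⟨‖b‖, b.opNorm_nonneg, fun x => ?_⟩
  rw [hb, ← Real.norm_eq_abs, sq, ← mul_assoc]
  exact b.le_opNorm₂ x x

/-- A midpoint convex function of at most quadratic growth is continuous. -/
lemma continuous_of_midpoint_convex {g : E → ℝ} {C : ℝ}
    (hmid : ∀ x d, g x ≤ (g (x + d) + g (x - d)) / 2) (hC : ∀ x, g x ≤ C * ‖x‖ ^ 2) :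
    Continuous g := by
  -- Convexity along a segment at dyadic points, by repeated halving.
  have key : ∀ (n : ℕ) (x u : E),
      g (x + (2⁻¹ : ℝ) ^ n • u) ≤ g x + (2⁻¹ : ℝ) ^ n * (g (x + u) - g x) := by
    intro n
    induction n with
    | zero => intro x u; simp
    | succ n ih =>
      intro x u
      have h1 := hmid (x + (2⁻¹ : ℝ) ^ (n + 1) • u) ((2⁻¹ : ℝ) ^ (n + 1) • u)
      have e : x + (2⁻¹ : ℝ) ^ (n + 1) • u + (2⁻¹ : ℝ) ^ (n + 1) • u
          = x + (2⁻¹ : ℝ) ^ n • u := by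
        rw [add_assoc, ← add_smul]; congr 2; ring
      rw [e, add_sub_cancel_right] at h1
      have h2 := ih x u
      rw [pow_succ]; rw [pow_succ] at h1
      linarith
  rw [continuous_iff_continuousAt]
  intro x
  set K := |C| * (‖x‖ + 1) ^ 2 + |g x| with hK
  have hK0 : 0 ≤ K := by positivity
  have up : ∀ (n : ℕ) (h : E), ‖h‖ ≤ (2⁻¹ : ℝ) ^ n → g (x + h) - g x ≤ (2⁻¹ : ℝ) ^ n * K := by
    intro n h hh
    have hp : (0 : ℝ) < (2⁻¹ : ℝ) ^ n := by positivity
    have h1 := key n x (((2⁻¹ : ℝ) ^ n)⁻¹ • h)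
    rw [smul_inv_smul₀ hp.ne'] at h1
    have hn : ‖((2⁻¹ : ℝ) ^ n)⁻¹ • h‖ ≤ 1 := by
      rw [norm_smul, norm_inv, Real.norm_of_nonneg hp.le]
      exact (inv_mul_le_one₀ hp).2 hh
    have h2 : g (x + ((2⁻¹ : ℝ) ^ n)⁻¹ • h) ≤ |C| * (‖x‖ + 1) ^ 2 := by
      refine (hC _).trans ((mul_le_mul_of_nonneg_right (le_abs_self C) (by positivity)).trans ?_)
      gcongr
      exact (norm_add_le _ _).trans (by linarith)
    have h3 : (2⁻¹ : ℝ) ^ n * (g (x + ((2⁻¹ : ℝ) ^ n)⁻¹ • h) - g x) ≤ (2⁻¹ : ℝ) ^ n * K := by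
      gcongr
      have := neg_abs_le (g x)
      linarith
    linarith
  rw [Metric.continuousAt_iff]
  intro ε hε
  obtain ⟨n, hn⟩ := exists_pow_lt_of_lt_one (show 0 < ε / (K + 1) by positivity)
    (show (2⁻¹ : ℝ) < 1 by norm_num)
  have hp : (0 : ℝ) < (2⁻¹ : ℝ) ^ n := by positivity
  refine ⟨(2⁻¹ : ℝ) ^ n, hp, fun y hy => ?_⟩
  rw [dist_eq_norm] at hy
  have h1 := up n (y - x) hy.le
  -- The upper bound at the reflected point `2x - y` becomes a lower bound at `y` by midpoint
  -- convexity at `x`.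
  have h2 := up n (-(y - x)) (by rw [norm_neg]; exact hy.le)
  have h3 := hmid x (y - x)
  rw [← sub_eq_add_neg] at h2
  rw [add_sub_cancel] at h1 h3
  have h4 : (2⁻¹ : ℝ) ^ n * K < ε := by
    rw [lt_div_iff₀ (by positivity)] at hn
    nlinarith
  rw [Real.dist_eq, abs_lt]
  constructor <;> linarith

/-- A continuous midpoint convex function is convex. -/
lemma convexOn_of_midpoint_convex {g : E → ℝ} (hg : Continuous g)
    (hmid : ∀ x d, g x ≤ (g (x + d) + g (x - d)) / 2) : ConvexOn ℝ Set.univ g := by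
  refine ⟨convex_univ, fun x _ y _ a c ha hc hac => ?_⟩
  set φ : ℝ → ℝ := fun t => g (x + t • (y - x)) - ((1 - t) * g x + t * g y) with hφ
  have hφc : Continuous φ := by fun_prop
  have hφm : ∀ t s, φ t ≤ (φ (t + s) + φ (t - s)) / 2 := by
    intro t s
    have := hmid (x + t • (y - x)) (s • (y - x))
    rw [add_assoc, add_sub_assoc, ← add_smul, ← sub_smul] at this
    simp only [hφ]
    linarith
  have h0 : φ 0 = 0 := by simp [hφ]
  have h1 : φ 1 = 0 := by simp [hφ]
  obtain ⟨t₀, ht₀, hmax⟩ := (isCompact_Icc (a := (0 : ℝ)) (b := 1)).exists_isMaxOn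
    ⟨0, by simp⟩ hφc.continuousOn
  -- Reflect the nearer endpoint of `[0, 1]` in the maximum point `t₀`. As `φ` vanishes at the
  -- endpoint, `φ t₀ ≤ φ t₀ / 2`.
  have hM : φ t₀ ≤ 0 := by
    obtain ⟨hl, hr⟩ := ht₀
    rcases le_total t₀ (1 / 2) with h | h
    · have h2 := hφm t₀ t₀
      have h3 : φ (t₀ + t₀) ≤ φ t₀ := hmax ⟨by linarith, by linarith⟩
      rw [sub_self, h0] at h2
      linarith
    · have h2 := hφm t₀ (1 - t₀)
      have h3 : φ (t₀ - (1 - t₀)) ≤ φ t₀ := hmax ⟨by linarith, by linarith⟩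
      rw [add_sub_cancel, h1] at h2
      linarith
  have h2 : φ c ≤ φ t₀ := hmax ⟨hc, by linarith⟩
  have e : a • x + c • y = x + c • (y - x) := by
    rw [← eq_sub_iff_add_eq] at hac
    rw [hac]; module
  have e' : (1 : ℝ) - c = a := by linarith
  simp only [hφ, e'] at h2 hM
  rw [e, smul_eq_mul, smul_eq_mul]
  linarith

theorem HasQuadraticControl.isDeltaConvex {q : E → ℝ} (hq : IsContQuadForm q)
    (h : HasQuadraticControl q) : IsDeltaConvex q := by
  obtain ⟨C, Ψ, -, hC, hΨ⟩ := h
  obtain ⟨K, -, hK⟩ := hq.exists_abs_le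
  have hm₁ : ∀ x d, (Ψ x + q x) / 2 ≤
      ((Ψ (x + d) + q (x + d)) / 2 + (Ψ (x - d) + q (x - d)) / 2) / 2 := by
    intro x d
    have := hΨ x d
    have := hq.parallelogram x d
    have := neg_abs_le (q d)
    linarith
  have hm₂ : ∀ x d, (Ψ x - q x) / 2 ≤
      ((Ψ (x + d) - q (x + d)) / 2 + (Ψ (x - d) - q (x - d)) / 2) / 2 := by
    intro x d
    have := hΨ x d
    have := hq.parallelogram x d
    have := le_abs_self (q d)
    linarith
  have hc₁ : Continuous fun x => (Ψ x + q x) / 2 := by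
    refine continuous_of_midpoint_convex (C := (C + K) / 2) hm₁ fun x => ?_
    have := hC x
    have := hK x
    have := le_abs_self (q x)
    linarith
  have hc₂ : Continuous fun x => (Ψ x - q x) / 2 := by
    refine continuous_of_midpoint_convex (C := (C + K) / 2) hm₂ fun x => ?_
    have := hC x
    have := hK x
    have := neg_abs_le (q x)
    linarith
  exact ⟨_, _, hc₁, hc₂, convexOn_of_midpoint_convex hc₁ hm₁,
    convexOn_of_midpoint_convex hc₂ hm₂, fun x => by ring⟩

/-- A delta-convex quadratic form is controlled by a function which is bounded on the
unit ball. -/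
lemma IsDeltaConvex.exists_local_control {q : E → ℝ} (hq : IsContQuadForm q)
    (h : IsDeltaConvex q) :
    ∃ (M : ℝ) (F : E → ℝ), 0 < M ∧ (∀ x, ‖x‖ ≤ 1 → 0 ≤ F x ∧ F x ≤ M) ∧
      ∀ x d, F x + |q d| ≤ (F (x + d) + F (x - d)) / 2 := by
  obtain ⟨g₁, g₂, c₁, c₂, v₁, v₂, hg⟩ := h
  have mid : ∀ {g : E → ℝ}, ConvexOn ℝ Set.univ g →
      ∀ x d, g x ≤ (g (x + d) + g (x - d)) / 2 := by
    intro g hv x d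
    have := hv.2 (Set.mem_univ (x + d)) (Set.mem_univ (x - d))
      (show (0 : ℝ) ≤ 1 / 2 by norm_num) (show (0 : ℝ) ≤ 1 / 2 by norm_num) (by norm_num)
    have e : (1 / 2 : ℝ) • (x + d) + (1 / 2 : ℝ) • (x - d) = x := by module
    rw [e, smul_eq_mul, smul_eq_mul] at this
    linarith
  set f : E → ℝ := fun x => g₁ x + g₂ x with hf
  have hfc : Continuous f := c₁.add c₂
  -- The second differences of `g₁` and `g₂` are nonnegative and differ by exactly `q d`, so their
  -- sum is at least `|q d|`.
  have hfq : ∀ x d, f x + |q d| ≤ (f (x + d) + f (x - d)) / 2 := by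
    intro x d
    have h1 := mid v₁ x d
    have h2 := mid v₂ x d
    have h3 := hq.parallelogram x d
    simp only [hg] at h3
    simp only [hf]
    rcases abs_cases (q d) with ⟨h, -⟩ | ⟨h, -⟩ <;> rw [h, hg] <;> linarith
  obtain ⟨δ, hδ, hball⟩ := Metric.continuousAt_iff.1 (hfc.continuousAt (x := 0)) 1 one_pos
  set r := δ / 2 with hr
  have hr0 : 0 < r := by positivity
  refine ⟨2 / r ^ 2, fun x => (f (r • x) - f 0 + 1) / r ^ 2, by positivity, fun x hx => ?_,
    fun x d => ?_⟩
  · have h1 : dist (r • x) 0 < δ := by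
      rw [dist_zero_right, norm_smul, Real.norm_of_nonneg hr0.le]
      have := mul_le_mul_of_nonneg_left hx hr0.le
      linarith
    have h2 := hball h1
    rw [Real.dist_eq, abs_lt] at h2
    constructor
    · have : 0 ≤ f (r • x) - f 0 + 1 := by linarith
      positivity
    · exact div_le_div_of_nonneg_right (by linarith) (sq_nonneg r)
  · have h1 := hfq (r • x) (r • d)
    rw [hq.map_smul, abs_mul, abs_of_nonneg (sq_nonneg r)] at h1
    simp only [smul_add, smul_sub]
    have h2 : (0 : ℝ) < r ^ 2 := by positivity
    rw [← sub_nonneg]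
    have h3 : ((f (r • x + r • d) - f 0 + 1) / r ^ 2 + (f (r • x - r • d) - f 0 + 1) / r ^ 2) / 2
        - ((f (r • x) - f 0 + 1) / r ^ 2 + |q d|)
        = ((f (r • x + r • d) + f (r • x - r • d)) / 2 - (f (r • x) + r ^ 2 * |q d|)) / r ^ 2 := by
      field_simp
      ring
    rw [h3]
    exact div_nonneg (by linarith) h2.le

/-- Since `q` is 2-homogeneous, each rescaling `V m` of the local control still controls `q`, but is
bounded only on the ball of radius `m`. A supremum over `m ≥ ‖x‖` joins them, after a correction
that is convex in `x` and penalizes large `m`. -/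
theorem IsDeltaConvex.hasQuadraticControl {q : E → ℝ} (hq : IsContQuadForm q)
    (h : IsDeltaConvex q) : HasQuadraticControl q := by
  obtain ⟨M, F, hM, hF, hFq⟩ := h.exists_local_control hq
  set V : ℝ → E → ℝ := fun m x => m ^ 2 * F (m⁻¹ • x) with hV
  have hVb : ∀ m x, ‖x‖ ≤ m → 0 ≤ V m x ∧ V m x ≤ M * m ^ 2 := by
    intro m x hx
    have hm : 0 ≤ m := (norm_nonneg x).trans hx
    have h1 : ‖m⁻¹ • x‖ ≤ 1 := by
      rw [norm_smul, norm_inv, Real.norm_of_nonneg hm]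
      exact inv_mul_le_one_of_le₀ hx hm
    obtain ⟨h2, h3⟩ := hF _ h1
    refine ⟨by positivity, ?_⟩
    rw [mul_comm M]
    exact mul_le_mul_of_nonneg_left h3 (sq_nonneg m)
  have hVq : ∀ m, 0 < m → ∀ x d, V m x + |q d| ≤ (V m (x + d) + V m (x - d)) / 2 := by
    intro m hm x d
    have h1 := hFq (m⁻¹ • x) (m⁻¹ • d)
    rw [hq.map_smul, abs_mul, abs_of_nonneg (sq_nonneg _)] at h1
    simp only [hV, smul_add, smul_sub]
    have h2 := mul_le_mul_of_nonneg_left h1 (sq_nonneg m)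
    have h3 : m ^ 2 * (m⁻¹ ^ 2 * |q d|) = |q d| := by
      field_simp
    rw [mul_add, h3] at h2
    linarith
  -- With `V m x ≤ M m²`, completing the square gives `Φ m x ≤ 64 M ‖x‖² - M (m - 8‖x‖)²`.
  set Φ : ℝ → E → ℝ := fun m x => V m x + 16 * M * m * ‖x‖ - 2 * M * m ^ 2 with hΦ
  have hΦC : ∀ m x, ‖x‖ ≤ m → Φ m x ≤ 64 * M * ‖x‖ ^ 2 := by
    intro m x hx
    have h1 := (hVb m x hx).2
    have h2 := mul_nonneg hM.le (sq_nonneg (m - 8 * ‖x‖))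
    simp only [hΦ]
    nlinarith
  set Ψ : E → ℝ := fun x => sSup ((fun m => Φ m x) '' Set.Ici ‖x‖) with hΨ
  have hle : ∀ m x, ‖x‖ ≤ m → Φ m x ≤ Ψ x := by
    intro m x hx
    refine le_csSup ⟨64 * M * ‖x‖ ^ 2, ?_⟩ ⟨m, hx, rfl⟩
    rintro _ ⟨m', hm', rfl⟩
    exact hΦC m' x hm'
  have hne : ∀ x : E, ((fun m => Φ m x) '' Set.Ici ‖x‖).Nonempty :=
    fun x => ⟨_, ‖x‖, le_refl ‖x‖, rfl⟩
  refine ⟨64 * M, Ψ, fun x => ?_, fun x => ?_, fun x d => ?_⟩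
  · refine le_trans ?_ (hle ‖x‖ x le_rfl)
    have h1 := (hVb ‖x‖ x le_rfl).1
    have h2 := mul_nonneg hM.le (sq_nonneg ‖x‖)
    simp only [hΦ]
    nlinarith
  · refine csSup_le (hne x) ?_
    rintro _ ⟨m', hm', rfl⟩
    exact hΦC m' x hm'
  · rw [← le_sub_iff_add_le]
    refine csSup_le (hne x) ?_
    rintro _ ⟨m, hm, rfl⟩
    rw [Set.mem_Ici] at hm
    rw [le_sub_iff_add_le]
    have hm0 : 0 ≤ m := (norm_nonneg x).trans hm
    have hy : 2 * ‖x‖ ≤ ‖x + d‖ + ‖x - d‖ := by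
      have := norm_add_le (x + d) (x - d)
      rwa [show x + d + (x - d) = (2 : ℝ) • x by module, norm_smul, Real.norm_ofNat] at this
    by_cases hc : ‖x + d‖ ≤ m ∧ ‖x - d‖ ≤ m
    · have h1 := hle m _ hc.1
      have h2 := hle m _ hc.2
      have h3 : V m x + |q d| ≤ (V m (x + d) + V m (x - d)) / 2 := by
        rcases hm0.eq_or_lt with h0 | h0
        · have hx0 : x = 0 := norm_le_zero_iff.1 (h0 ▸ hm)
          have hd0 : d = 0 := by
            have := hc.1
            rw [hx0, zero_add, ← h0] at this
            exact norm_le_zero_iff.1 this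
          have hq0 : q 0 = 0 := by simpa using hq.map_smul 0 0
          simp [hx0, hd0, hq0]
        · exact hVq m h0 x d
      have h4 := mul_le_mul_of_nonneg_left hy (mul_nonneg hM.le hm0)
      simp only [hΦ] at h1 h2 ⊢
      linarith
    -- A point `x ± d` leaves the ball of radius `m`, so pass to the index `2s`. Half of the linear
    -- term there, `16 M s (‖x + d‖ + ‖x - d‖)`, absorbs `16 M m ‖x‖`, and the other half absorbs
    -- the penalty `8 M s²`.
    · set s := max ‖x + d‖ ‖x - d‖ with hs
      have hms : m < s := by
        by_contra! hcon
        exact hc ⟨(le_max_left _ _).trans hcon, (le_max_right _ _).trans hcon⟩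
      have ha : ‖x + d‖ ≤ s := le_max_left _ _
      have hb : ‖x - d‖ ≤ s := le_max_right _ _
      have hab : s ≤ ‖x + d‖ + ‖x - d‖ :=
        max_le (by linarith [norm_nonneg (x - d)]) (by linarith [norm_nonneg (x + d)])
      have hs0 : 0 < s := hm0.trans_lt hms
      have h1 := hle (2 * s) (x + d) (by linarith)
      have h2 := hle (2 * s) (x - d) (by linarith)
      have h3 := hVq (2 * s) (by linarith) x d
      have h4 := (hVb (2 * s) x (by linarith)).1
      have h5 := (hVb m x hm).2
      have h6 := mul_le_mul_of_nonneg_left hy (mul_nonneg hM.le hs0.le)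
      have h7 := mul_le_mul_of_nonneg_left hab (mul_nonneg hM.le hs0.le)
      have h8 : M * (m * ‖x‖) ≤ M * (s * ‖x‖) := by gcongr
      have h9 := mul_nonneg hM.le (sq_nonneg m)
      simp only [hΦ] at h1 h2 ⊢
      nlinarith

end Control

/-! ### Expectation over signs. -/

section SignExpectation

variable {n : ℕ}

lemma signExpectation_mono {f g : (Fin n → ℤˣ) → ℝ} (h : ∀ ω, f ω ≤ g ω) :
    signExpectation f ≤ signExpectation g :=
  mul_le_mul_of_nonneg_left (Finset.sum_le_sum fun ω _ => h ω) (by positivity)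

lemma signExpectation_add (f g : (Fin n → ℤˣ) → ℝ) :
    signExpectation (fun ω => f ω + g ω) = signExpectation f + signExpectation g := by
  simp only [signExpectation, Finset.sum_add_distrib, mul_add]

lemma signExpectation_const_mul (c : ℝ) (f : (Fin n → ℤˣ) → ℝ) :
    signExpectation (fun ω => c * f ω) = c * signExpectation f := by
  simp only [signExpectation, ← Finset.mul_sum]
  ring

lemma signExpectation_sum {ι : Type*} (s : Finset ι) (f : ι → (Fin n → ℤˣ) → ℝ) :
    signExpectation (fun ω => ∑ i ∈ s, f i ω) = ∑ i ∈ s, signExpectation (f i) := by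
  simp only [signExpectation]
  rw [Finset.sum_comm, Finset.mul_sum]

lemma signExpectation_nonneg {f : (Fin n → ℤˣ) → ℝ} (h : ∀ ω, 0 ≤ f ω) :
    0 ≤ signExpectation f :=
  mul_nonneg (by positivity) (Finset.sum_nonneg fun ω _ => h ω)

lemma signExpectation_fin_zero (f : (Fin 0 → ℤˣ) → ℝ) : signExpectation f = f default := by
  simp only [signExpectation, pow_zero, inv_one, one_mul, Fintype.sum_unique]
  exact congrArg f (Subsingleton.elim _ _)

lemma signExpectation_fin_succ (f : (Fin (n + 1) → ℤˣ) → ℝ) :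
    signExpectation f = (signExpectation (fun ω => f (Fin.cons 1 ω))
      + signExpectation (fun ω => f (Fin.cons (-1) ω))) / 2 := by
  have h : ∑ ω, f ω = ∑ ω, f (Fin.cons 1 ω) + ∑ ω, f (Fin.cons (-1) ω) := by
    rw [← (Fin.consEquiv fun _ => ℤˣ).sum_comp, Fintype.sum_prod_type]
    exact Finset.sum_pair (by decide)
  simp only [signExpectation, h, pow_succ, mul_inv]
  ring

/-- The change of the sign of one coordinate. -/
def flipSign (k : Fin n) (ω : Fin n → ℤˣ) : Fin n → ℤˣ := Function.update ω k (-ω k)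

lemma flipSign_involutive (k : Fin n) : Function.Involutive (flipSign k) := by
  intro ω
  simp [flipSign]

lemma flipSign_of_ne {k i : Fin n} (h : i ≠ k) (ω : Fin n → ℤˣ) : flipSign k ω i = ω i :=
  Function.update_of_ne h _ _

lemma signExpectation_flipSign (k : Fin n) (f : (Fin n → ℤˣ) → ℝ) :
    signExpectation (fun ω => f (flipSign k ω)) = signExpectation f := by
  simp only [signExpectation]
  exact congrArg _ (Equiv.sum_comp ((flipSign_involutive k).toPerm _) f)

/-- A sign flip preserves the measure. This averaging replaces conditional expectations throughout.
-/
lemma signExpectation_eq_average (k : Fin n) (f : (Fin n → ℤˣ) → ℝ) :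
    signExpectation (fun ω => (f ω + f (flipSign k ω)) / 2) = signExpectation f := by
  simp only [div_eq_inv_mul, signExpectation_const_mul, signExpectation_add,
    signExpectation_flipSign]
  ring

end SignExpectation

/-! ### Walsh-Paley martingales. -/

namespace IsWalshPaleyMartingale

/-- Two martingales of length `n`, put together by the first sign to one
of length `n + 1` with initial value `x`. -/
def glue {α : Type*} {n : ℕ} (x : α) (f : ℤˣ → Fin (n + 1) → (Fin n → ℤˣ) → α) :
    Fin (n + 1 + 1) → (Fin (n + 1) → ℤˣ) → α :=
  fun k ω => Fin.cases (motive := fun _ => α) x (fun j => f (ω 0) j (Fin.tail ω)) k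

@[simp] lemma glue_zero {α : Type*} {n : ℕ} (x : α) (f : ℤˣ → Fin (n + 1) → (Fin n → ℤˣ) → α)
    (ω : Fin (n + 1) → ℤˣ) : glue x f 0 ω = x := rfl

@[simp] lemma glue_succ {α : Type*} {n : ℕ} (x : α) (f : ℤˣ → Fin (n + 1) → (Fin n → ℤˣ) → α)
    (j : Fin (n + 1)) (ω : Fin (n + 1) → ℤˣ) : glue x f j.succ ω = f (ω 0) j (Fin.tail ω) := rfl

variable {E : Type u} [NormedAddCommGroup E] [NormedSpace ℝ E]
  {F : Type v} [NormedAddCommGroup F] [NormedSpace ℝ F] {n : ℕ}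
  {f : Fin (n + 1) → (Fin n → ℤˣ) → E} {g : Fin (n + 1) → (Fin n → ℤˣ) → F}

lemma apply_flipSign (hf : IsWalshPaleyMartingale f) {j : Fin (n + 1)} {k : Fin n}
    (hjk : (j : ℕ) ≤ k) (ω : Fin n → ℤˣ) : f j (flipSign k ω) = f j ω := by
  refine hf.adapted j _ _ fun i hi => flipSign_of_ne ?_ ω
  rintro rfl
  omega

lemma eq_average_flipSign (hf : IsWalshPaleyMartingale f) (k : Fin n) (ω : Fin n → ℤˣ) :
    f k.castSucc ω = (1 / 2 : ℝ) • f k.succ ω + (1 / 2 : ℝ) • f k.succ (flipSign k ω) := by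
  rw [hf.average k ω, flipSign]
  rcases Int.units_eq_one_or (ω k) with h | h
  · rw [h, add_comm]
    congr 3
    rw [← h, Function.update_eq_self]
  · rw [h, neg_neg]
    congr 3
    rw [← h, Function.update_eq_self]

lemma succ_flipSign (hf : IsWalshPaleyMartingale f) (k : Fin n) (ω : Fin n → ℤˣ) :
    f k.succ (flipSign k ω) = f k.castSucc ω - (f k.succ ω - f k.castSucc ω) := by
  have h := hf.eq_average_flipSign k ω
  have : f k.succ (flipSign k ω) = (2 : ℝ) • f k.castSucc ω - f k.succ ω := by
    rw [h]; module
  rw [this]; module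

lemma map (hf : IsWalshPaleyMartingale f) (T : E →ₗ[ℝ] F) :
    IsWalshPaleyMartingale (fun k ω => T (f k ω)) where
  adapted k ω ω' h := congrArg T (hf.adapted k ω ω' h)
  average k ω := by rw [hf.average k ω]; simp only [map_add, map_smul]

lemma prodMk (hf : IsWalshPaleyMartingale f) (hg : IsWalshPaleyMartingale g) :
    IsWalshPaleyMartingale (fun k ω => (f k ω, g k ω)) where
  adapted k ω ω' h := Prod.ext (hf.adapted k ω ω' h) (hg.adapted k ω ω' h)
  average k ω := Prod.ext (hf.average k ω) (hg.average k ω)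

lemma const_of_zero (h : (Fin 0 → ℤˣ) → E) :
    IsWalshPaleyMartingale (fun (_ : Fin (0 + 1)) => h) where
  adapted _ ω ω' _ := congrArg h (Subsingleton.elim ω ω')
  average k := k.elim0

lemma isWalshPaleyMartingale_glue {x d : E} {f : ℤˣ → Fin (n + 1) → (Fin n → ℤˣ) → E}
    (hf : ∀ s, IsWalshPaleyMartingale (f s)) (hp : ∀ ω, f 1 0 ω = x + d)
    (hm : ∀ ω, f (-1) 0 ω = x - d) : IsWalshPaleyMartingale (glue x f) where
  adapted k ω ω' h := by
    induction k using Fin.cases with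
    | zero => rfl
    | succ j =>
      rw [glue_succ, glue_succ, h 0 (by simp)]
      exact (hf _).adapted j _ _ fun i hi => h i.succ (by simpa using hi)
  average k ω := by
    induction k using Fin.cases with
    | zero =>
      rw [Fin.castSucc_zero, glue_zero, glue_succ, glue_succ]
      simp only [Function.update_self, hp, hm]
      module
    | succ j =>
      rw [← Fin.succ_castSucc, glue_succ, glue_succ, glue_succ, (hf _).average j]
      simp only [Fin.tail_update_succ]
      rw [Function.update_of_ne (Fin.succ_ne_zero j).symm,
        Function.update_of_ne (Fin.succ_ne_zero j).symm]

/-- Each function on `{-1, 1}ⁿ` is the last term of a Walsh-Paley martingale. -/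
lemma exists_last_eq (h : (Fin n → ℤˣ) → E) :
    ∃ f : Fin (n + 1) → (Fin n → ℤˣ) → E,
      IsWalshPaleyMartingale f ∧ ∀ ω, f (Fin.last n) ω = h ω := by
  induction n with
  | zero => exact ⟨_, const_of_zero h, fun ω => rfl⟩
  | succ n ih =>
    choose f hf hlast using fun s : ℤˣ => ih fun ω => h (Fin.cons s ω)
    have h0 : ∀ s ω, f s 0 ω = f s 0 1 := fun s ω => (hf s).adapted 0 _ _ (by simp)
    refine ⟨glue ((1 / 2 : ℝ) • (f 1 0 1 + f (-1) 0 1)) f,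
      isWalshPaleyMartingale_glue (d := (1 / 2 : ℝ) • (f 1 0 1 - f (-1) 0 1)) hf
        (fun ω => ?_) (fun ω => ?_), fun ω => ?_⟩
    · rw [h0]; module
    · rw [h0]; module
    · rw [← Fin.succ_last, glue_succ, hlast, Fin.cons_self_tail]

/-- Orthogonality of increments. Flipping a later sign `j` reverses `dgⱼ` and fixes `dfₖ`, which
removes the increments of `g` after `k`; flipping the sign `k` reverses both `dfₖ` and `dgₖ`, which
removes the past of `g`. -/
lemma signExpectation_diff_last (hf : IsWalshPaleyMartingale f) (hg : IsWalshPaleyMartingale g)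
    (b : E →L[ℝ] F →L[ℝ] ℝ) (k : Fin n) :
    signExpectation (fun ω => b (f k.succ ω - f k.castSucc ω) (g (Fin.last n) ω))
      = signExpectation
          (fun ω => b (f k.succ ω - f k.castSucc ω) (g k.succ ω - g k.castSucc ω)) := by
  have h1 : ∀ j : Fin (n + 1), k.succ ≤ j →
      signExpectation (fun ω => b (f k.succ ω - f k.castSucc ω) (g (Fin.last n) ω))
        = signExpectation (fun ω => b (f k.succ ω - f k.castSucc ω) (g j ω)) := by
    intro j
    induction j using Fin.reverseInduction with
    | last => intro _; rfl
    | cast j ih =>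
      intro hj
      have hkj : (k : ℕ) + 1 ≤ j := Fin.le_def.1 hj
      rw [ih (Fin.le_def.2 (show (k : ℕ) + 1 ≤ j + 1 by omega)), ← signExpectation_eq_average j]
      congr 1
      funext ω
      rw [hf.apply_flipSign (j := k.succ) (by simpa using hkj),
        hf.apply_flipSign (j := k.castSucc) (by simp; omega), hg.succ_flipSign]
      simp only [map_sub, FunLike.coe_sub, Pi.sub_apply]
      ring
  rw [h1 k.succ le_rfl, ← signExpectation_eq_average k]
  congr 1
  funext ω
  rw [hf.apply_flipSign (j := k.castSucc) (by simp), hg.succ_flipSign, hf.succ_flipSign]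
  simp only [map_sub, FunLike.coe_sub, Pi.sub_apply]
  ring

end IsWalshPaleyMartingale

/-! ### Martingale transforms; UMD for products and duals. -/

section Transform

variable {E : Type u} [NormedAddCommGroup E] [NormedSpace ℝ E]
  {F : Type v} [NormedAddCommGroup F] [NormedSpace ℝ F] {n : ℕ}
  {f : Fin (n + 1) → (Fin n → ℤˣ) → E} {g : Fin (n + 1) → (Fin n → ℤˣ) → F}

/-- The martingale transform `∑ εₖ dfₖ`. -/
def signTransform (ε : Fin n → ℤˣ) (f : Fin (n + 1) → (Fin n → ℤˣ) → E) (ω : Fin n → ℤˣ) : E :=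
  ∑ k : Fin n, ((ε k : ℤ) : ℝ) • (f k.succ ω - f k.castSucc ω)

lemma isUMDSpace_iff : IsUMDSpace E ↔ ∃ C : ℝ, 0 < C ∧
    ∀ (n : ℕ) (f : Fin (n + 1) → (Fin n → ℤˣ) → E), IsWalshPaleyMartingale f →
      ∀ ε : Fin n → ℤˣ, signExpectation (fun ω => ‖signTransform ε f ω‖ ^ 2)
        ≤ C * signExpectation (fun ω => ‖f (Fin.last n) ω‖ ^ 2) :=
  Iff.rfl

lemma IsWalshPaleyMartingale.signExpectation_signTransform_left
    (hf : IsWalshPaleyMartingale f) (hg : IsWalshPaleyMartingale g)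
    (b : E →L[ℝ] F →L[ℝ] ℝ) (ε : Fin n → ℤˣ) :
    signExpectation (fun ω => b (signTransform ε f ω) (g (Fin.last n) ω))
      = signExpectation (fun ω => ∑ k : Fin n, ((ε k : ℤ) : ℝ) *
          b (f k.succ ω - f k.castSucc ω) (g k.succ ω - g k.castSucc ω)) := by
  rw [signExpectation_sum]
  simp only [signExpectation_const_mul, ← hf.signExpectation_diff_last hg b]
  simp only [← signExpectation_const_mul]
  rw [← signExpectation_sum]
  congr 1
  funext ω
  simp only [signTransform, map_sum, map_smul, sum_apply, smul_apply, smul_eq_mul]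

lemma IsWalshPaleyMartingale.signExpectation_signTransform_comm
    (hf : IsWalshPaleyMartingale f) (hg : IsWalshPaleyMartingale g)
    (b : E →L[ℝ] F →L[ℝ] ℝ) (ε : Fin n → ℤˣ) :
    signExpectation (fun ω => b (signTransform ε f ω) (g (Fin.last n) ω))
      = signExpectation (fun ω => b (f (Fin.last n) ω) (signTransform ε g ω)) := by
  rw [hf.signExpectation_signTransform_left hg b ε]
  exact (hg.signExpectation_signTransform_left hf b.flip ε).symm

lemma signTransform_map (ε : Fin n → ℤˣ) (T : E →ₗ[ℝ] F) (ω : Fin n → ℤˣ) :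
    signTransform ε (fun k ω => T (f k ω)) ω = T (signTransform ε f ω) := by
  simp only [signTransform, map_sum, map_smul, map_sub]

theorem IsUMDSpace.prod (hE : IsUMDSpace E) (hF : IsUMDSpace F) : IsUMDSpace (E × F) := by
  rw [isUMDSpace_iff] at *
  obtain ⟨C, hC, hE⟩ := hE
  obtain ⟨D, hD, hF⟩ := hF
  refine ⟨C + D, by positivity, fun n f hf ε => ?_⟩
  have h1 := hE n _ (hf.map (LinearMap.fst ℝ E F)) ε
  have h2 := hF n _ (hf.map (LinearMap.snd ℝ E F)) ε
  have e1 : ∀ ω, signTransform ε (fun k ω => (f k ω).1) ω = (signTransform ε f ω).1 :=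
    signTransform_map ε (LinearMap.fst ℝ E F)
  have e2 : ∀ ω, signTransform ε (fun k ω => (f k ω).2) ω = (signTransform ε f ω).2 :=
    signTransform_map ε (LinearMap.snd ℝ E F)
  simp only [LinearMap.fst_apply, e1] at h1
  simp only [LinearMap.snd_apply, e2] at h2
  have h3 : signExpectation (fun ω => ‖signTransform ε f ω‖ ^ 2)
      ≤ signExpectation (fun ω => ‖(signTransform ε f ω).1‖ ^ 2)
        + signExpectation (fun ω => ‖(signTransform ε f ω).2‖ ^ 2) := by
    rw [← signExpectation_add]
    refine signExpectation_mono fun ω => ?_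
    rw [Prod.norm_def]
    rcases max_choice ‖(signTransform ε f ω).1‖ ‖(signTransform ε f ω).2‖ with h | h <;> rw [h]
    · linarith [sq_nonneg ‖(signTransform ε f ω).2‖]
    · linarith [sq_nonneg ‖(signTransform ε f ω).1‖]
  have h4 : signExpectation (fun ω => ‖(f (Fin.last n) ω).1‖ ^ 2)
      ≤ signExpectation (fun ω => ‖f (Fin.last n) ω‖ ^ 2) :=
    signExpectation_mono fun ω => pow_le_pow_left₀ (norm_nonneg _) (norm_fst_le _) 2
  have h5 : signExpectation (fun ω => ‖(f (Fin.last n) ω).2‖ ^ 2)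
      ≤ signExpectation (fun ω => ‖f (Fin.last n) ω‖ ^ 2) :=
    signExpectation_mono fun ω => pow_le_pow_left₀ (norm_nonneg _) (norm_snd_le _) 2
  have h6 := mul_le_mul_of_nonneg_left h4 hC.le
  have h7 := mul_le_mul_of_nonneg_left h5 hD.le
  linarith

/-- The norm of `φ` need not be attained, hence the factor 2. -/
lemma exists_norm_le_and_le_apply (φ : StrongDual ℝ E) :
    ∃ x : E, ‖x‖ ≤ ‖φ‖ ∧ ‖φ‖ ^ 2 ≤ 2 * φ x := by
  rcases eq_or_ne φ 0 with rfl | h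
  · exact ⟨0, by simp⟩
  have h0 : 0 < ‖φ‖ := norm_pos_iff.2 h
  obtain ⟨x, hx1, hx2⟩ := φ.exists_lt_apply_of_lt_opNorm (half_lt_self h0)
  rw [Real.norm_eq_abs] at hx2
  have key : ∃ y : E, ‖y‖ < 1 ∧ ‖φ‖ / 2 < φ y := by
    rcases abs_cases (φ x) with ⟨h, -⟩ | ⟨h, -⟩
    · exact ⟨x, hx1, h ▸ hx2⟩
    · exact ⟨-x, by rwa [norm_neg], by rw [map_neg]; exact h ▸ hx2⟩
  obtain ⟨y, hy1, hy2⟩ := key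
  refine ⟨‖φ‖ • y, ?_, ?_⟩
  · rw [norm_smul, norm_norm]
    exact mul_le_of_le_one_right h0.le hy1.le
  · rw [map_smul, smul_eq_mul]
    nlinarith

/-- Sign transforms are self-adjoint for the pairing. Test the transform of `g` against a martingale
`f` whose last value almost norms it, and move the transform to `f`, where UMD of `E` applies. -/
theorem IsUMDSpace.strongDual (hE : IsUMDSpace E) : IsUMDSpace (StrongDual ℝ E) := by
  rw [isUMDSpace_iff] at *
  obtain ⟨C, hC, hE⟩ := hE
  refine ⟨4 * C, by positivity, fun n g hg ε => ?_⟩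
  choose x hx1 hx2 using fun ω => exists_norm_le_and_le_apply (signTransform ε g ω)
  obtain ⟨f, hf, hfx⟩ := IsWalshPaleyMartingale.exists_last_eq x
  have h1 := hE n f hf ε
  have h2 : signExpectation (fun ω => ‖f (Fin.last n) ω‖ ^ 2)
      ≤ signExpectation (fun ω => ‖signTransform ε g ω‖ ^ 2) := by
    refine signExpectation_mono fun ω => ?_
    rw [hfx]
    exact pow_le_pow_left₀ (norm_nonneg _) (hx1 ω) 2
  have h3 : signExpectation (fun ω => ‖signTransform ε g ω‖ ^ 2)
      ≤ 2 * signExpectation (fun ω => signTransform ε g ω (f (Fin.last n) ω)) := by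
    rw [← signExpectation_const_mul]
    refine signExpectation_mono fun ω => ?_
    rw [hfx]
    exact hx2 ω
  have h4 := hg.signExpectation_signTransform_comm hf (ContinuousLinearMap.id ℝ (StrongDual ℝ E)) ε
  simp only [ContinuousLinearMap.id_apply] at h4
  -- Young's inequality, weighted so that the UMD bound for `f` leaves a quarter of the left side,
  -- which after the factor 2 from norming is absorbed.
  have h5 : signExpectation (fun ω => g (Fin.last n) ω (signTransform ε f ω))
      ≤ C * signExpectation (fun ω => ‖g (Fin.last n) ω‖ ^ 2)
        + (4 * C)⁻¹ * signExpectation (fun ω => ‖signTransform ε f ω‖ ^ 2) := by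
    rw [← signExpectation_const_mul, ← signExpectation_const_mul, ← signExpectation_add]
    refine signExpectation_mono fun ω => ?_
    set a := ‖g (Fin.last n) ω‖ with ha
    set c := ‖signTransform ε f ω‖ with hc
    have h6 : g (Fin.last n) ω (signTransform ε f ω) ≤ a * c :=
      (le_abs_self _).trans ((g (Fin.last n) ω).le_opNorm _)
    have h7 : C * a ^ 2 + (4 * C)⁻¹ * c ^ 2 - a * c = (4 * C)⁻¹ * (2 * C * a - c) ^ 2 := by
      field_simp
      ring
    have h8 : 0 ≤ (4 * C)⁻¹ * (2 * C * a - c) ^ 2 := by positivity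
    linarith
  have h9 : (4 * C)⁻¹ * signExpectation (fun ω => ‖signTransform ε f ω‖ ^ 2)
      ≤ 4⁻¹ * signExpectation (fun ω => ‖signTransform ε g ω‖ ^ 2) := by
    calc _ ≤ (4 * C)⁻¹ * (C * signExpectation (fun ω => ‖signTransform ε g ω‖ ^ 2)) := by
          gcongr
          exact h1.trans (mul_le_mul_of_nonneg_left h2 hC.le)
      _ = _ := by field_simp
  linarith

end Transform

/-! ### From control of the pairing form to UMD. -/

section ControlToUMD

variable {E : Type u} [NormedAddCommGroup E] [NormedSpace ℝ E]

lemma Fin.sum_succ_sub_castSucc {n : ℕ} (a : Fin (n + 1) → ℝ) :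
    ∑ k : Fin n, (a k.succ - a k.castSucc) = a (Fin.last n) - a 0 := by
  have h1 := Fin.sum_univ_succ a
  have h2 := Fin.sum_univ_castSucc a
  rw [Finset.sum_sub_distrib]
  linarith

/-- At each step `𝔼 Ψ(fₖ)` grows by at least `𝔼 |q (dfₖ)|`, so the sum telescopes. -/
lemma HasQuadraticControl.exists_signExpectation_le {q : E → ℝ} (hq : HasQuadraticControl q) :
    ∃ C : ℝ, 0 < C ∧ ∀ (n : ℕ) (f : Fin (n + 1) → (Fin n → ℤˣ) → E), IsWalshPaleyMartingale f →
      signExpectation (fun ω => ∑ k : Fin n, |q (f k.succ ω - f k.castSucc ω)|)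
        ≤ C * signExpectation (fun ω => ‖f (Fin.last n) ω‖ ^ 2) := by
  obtain ⟨C, Ψ, h0, hC, hΨ⟩ := hq
  refine ⟨max C 1, by positivity, fun n f hf => ?_⟩
  have h1 : ∀ k : Fin n, signExpectation (fun ω => |q (f k.succ ω - f k.castSucc ω)|)
      ≤ signExpectation (fun ω => Ψ (f k.succ ω))
        - signExpectation (fun ω => Ψ (f k.castSucc ω)) := by
    intro k
    rw [le_sub_iff_add_le', ← signExpectation_add,
      ← signExpectation_eq_average k (fun ω => Ψ (f k.succ ω))]
    refine signExpectation_mono fun ω => ?_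
    have h2 := hΨ (f k.castSucc ω) (f k.succ ω - f k.castSucc ω)
    rwa [add_sub_cancel, ← hf.succ_flipSign] at h2
  have h3 : signExpectation (fun ω => Ψ (f (Fin.last n) ω))
      ≤ max C 1 * signExpectation (fun ω => ‖f (Fin.last n) ω‖ ^ 2) := by
    rw [← signExpectation_const_mul]
    exact signExpectation_mono fun ω => (hC _).trans
      (mul_le_mul_of_nonneg_right (le_max_left _ _) (sq_nonneg _))
  rw [signExpectation_sum]
  refine (Finset.sum_le_sum fun k _ => h1 k).trans ?_
  rw [Fin.sum_succ_sub_castSucc (fun k => signExpectation (fun ω => Ψ (f k ω)))]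
  have h4 : 0 ≤ signExpectation (fun ω => Ψ (f 0 ω)) := signExpectation_nonneg fun ω => h0 _
  linarith

lemma exists_dual_norm_le_and_apply_eq (x : E) :
    ∃ φ : StrongDual ℝ E, ‖φ‖ ≤ ‖x‖ ∧ φ x = ‖x‖ ^ 2 := by
  obtain ⟨φ, h1, h2⟩ := exists_dual_vector'' ℝ x
  refine ⟨‖x‖ • φ, ?_, ?_⟩
  · rw [norm_smul, norm_norm]
    exact mul_le_of_le_one_right (norm_nonneg x) h1
  · rw [smul_apply, h2, smul_eq_mul, sq]
    rfl

lemma isContQuadForm_pairingForm : IsContQuadForm (pairingForm E) :=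
  ⟨(ContinuousLinearMap.id ℝ (StrongDual ℝ E)).bilinearComp
    (ContinuousLinearMap.snd ℝ E (StrongDual ℝ E)) (ContinuousLinearMap.fst ℝ E (StrongDual ℝ E)),
    fun _ => rfl⟩

theorem isUMDSpace_of_hasQuadraticControl_pairingForm (h : HasQuadraticControl (pairingForm E)) :
    IsUMDSpace E := by
  obtain ⟨C, hC, h⟩ := h.exists_signExpectation_le
  rw [isUMDSpace_iff]
  refine ⟨4 * C ^ 2, by positivity, fun n f hf ε => ?_⟩
  choose φ hφ1 hφ2 using fun ω => exists_dual_norm_le_and_apply_eq (signTransform ε f ω)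
  obtain ⟨g, hg, hgφ⟩ := IsWalshPaleyMartingale.exists_last_eq φ
  -- Scaling the dual martingale by `t` makes the pairing linear in `t` but its cost quadratic. This
  -- `t` has `C t² = t / 2`, so half of the left side survives.
  set t : ℝ := (2 * C)⁻¹ with ht
  set T : StrongDual ℝ E →ₗ[ℝ] StrongDual ℝ E := t • LinearMap.id with hT
  have ht0 : 0 < t := by positivity
  have h1 := h n _ (hf.prodMk (hg.map T))
  have h2 : signExpectation (fun ω => ‖signTransform ε f ω‖ ^ 2)
      = signExpectation (fun ω => ∑ k : Fin n, ((ε k : ℤ) : ℝ) *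
          (g k.succ ω - g k.castSucc ω) (f k.succ ω - f k.castSucc ω)) := by
    refine Eq.trans ?_ (hf.signExpectation_signTransform_left hg
      (ContinuousLinearMap.id ℝ (StrongDual ℝ E)).flip ε)
    congr 1
    funext ω
    rw [hgφ]
    exact (hφ2 ω).symm
  have h3 : t * signExpectation (fun ω => ‖signTransform ε f ω‖ ^ 2)
      ≤ C * signExpectation (fun ω => ‖f (Fin.last n) ω‖ ^ 2)
        + C * t ^ 2 * signExpectation (fun ω => ‖signTransform ε f ω‖ ^ 2) := by
    rw [h2, ← signExpectation_const_mul, ← h2]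
    refine le_trans (signExpectation_mono fun ω => ?_) (h1.trans ?_)
    · rw [Finset.mul_sum]
      refine Finset.sum_le_sum fun k _ => (le_abs_self _).trans_eq ?_
      have e : |((ε k : ℤ) : ℝ)| = 1 := by
        rcases Int.units_eq_one_or (ε k) with h | h <;> simp [h]
      simp only [pairingForm, hT, LinearMap.smul_apply, LinearMap.id_apply, Prod.mk_sub_mk,
        ← smul_sub, smul_apply, smul_eq_mul, abs_mul, e, one_mul]
    · rw [mul_assoc, ← mul_add, ← signExpectation_const_mul (t ^ 2), ← signExpectation_add]
      refine mul_le_mul_of_nonneg_left (signExpectation_mono fun ω => ?_) hC.le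
      have h4 : ‖T (g (Fin.last n) ω)‖ ^ 2
          ≤ t ^ 2 * ‖signTransform ε f ω‖ ^ 2 := by
        rw [hT, LinearMap.smul_apply, LinearMap.id_apply, hgφ, norm_smul, mul_pow,
          Real.norm_of_nonneg ht0.le]
        gcongr
        exact hφ1 ω
      rw [Prod.norm_def]
      rcases max_choice ‖f (Fin.last n) ω‖ ‖T (g (Fin.last n) ω)‖ with h | h
      · simp only [h]
        nlinarith [mul_nonneg (sq_nonneg t) (sq_nonneg ‖signTransform ε f ω‖)]
      · simp only [h]
        linarith [sq_nonneg ‖f (Fin.last n) ω‖]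
  have h5 : C * t ^ 2 = t / 2 := by rw [ht]; field_simp
  rw [h5] at h3
  have h6 : t / 2 * signExpectation (fun ω => ‖signTransform ε f ω‖ ^ 2)
      ≤ C * signExpectation (fun ω => ‖f (Fin.last n) ω‖ ^ 2) := by linarith
  have h7 : t / 2 * (4 * C) = 1 := by rw [ht]; field_simp; norm_num
  calc _ = 4 * C * (t / 2 * signExpectation (fun ω => ‖signTransform ε f ω‖ ^ 2)) := by
        rw [← mul_assoc, mul_comm (4 * C), h7, one_mul]
    _ ≤ 4 * C * (C * signExpectation (fun ω => ‖f (Fin.last n) ω‖ ^ 2)) := by gcongr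
    _ = _ := by ring

end ControlToUMD

/-! ### From UMD to control: a Burkholder function. -/

section UMDToControl

variable {E : Type u} [NormedAddCommGroup E] [NormedSpace ℝ E]

/-- By orthogonality the signed sum has the expectation of `b` evaluated at the transform and `fₙ`;
UMD bounds the transform. -/
lemma IsUMDSpace.exists_signExpectation_le (hE : IsUMDSpace E) {q : E → ℝ}
    (hq : IsContQuadForm q) :
    ∃ C : ℝ, 0 < C ∧ ∀ (n : ℕ) (f : Fin (n + 1) → (Fin n → ℤˣ) → E), IsWalshPaleyMartingale f →
      ∀ ε : Fin n → ℤˣ, signExpectation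
          (fun ω => ∑ k : Fin n, ((ε k : ℤ) : ℝ) * q (f k.succ ω - f k.castSucc ω))
        ≤ C * signExpectation (fun ω => ‖f (Fin.last n) ω‖ ^ 2) := by
  obtain ⟨C, hC, hE⟩ := isUMDSpace_iff.1 hE
  obtain ⟨b, hb⟩ := hq
  refine ⟨(‖b‖ + 1) * (C + 1), by have := b.opNorm_nonneg; positivity, fun n f hf ε => ?_⟩
  simp only [hb]
  rw [← hf.signExpectation_signTransform_left hf b ε]
  have hb0 := b.opNorm_nonneg
  calc _ ≤ signExpectation (fun ω => (‖b‖ + 1) *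
          (‖signTransform ε f ω‖ ^ 2 + ‖f (Fin.last n) ω‖ ^ 2)) := by
        refine signExpectation_mono fun ω => ?_
        refine (le_abs_self _).trans ((b.le_opNorm₂ _ _).trans ?_)
        rw [mul_assoc]
        refine mul_le_mul (by linarith) ?_ (by positivity) (by linarith)
        nlinarith [sq_nonneg (‖signTransform ε f ω‖ - ‖f (Fin.last n) ω‖),
          sq_nonneg (‖signTransform ε f ω‖ + ‖f (Fin.last n) ω‖)]
    _ = (‖b‖ + 1) * (signExpectation (fun ω => ‖signTransform ε f ω‖ ^ 2)
          + signExpectation (fun ω => ‖f (Fin.last n) ω‖ ^ 2)) := by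
        rw [signExpectation_const_mul, signExpectation_add]
    _ ≤ _ := by
        rw [mul_assoc]
        refine mul_le_mul_of_nonneg_left ?_ (by linarith)
        linarith [hE n f hf ε]

/-- Signs which alternate, counted from the last one. -/
def alternatingSign (n : ℕ) (k : Fin n) : ℤˣ := (-1) ^ (n - (k : ℕ))

lemma alternatingSign_succ (n : ℕ) (k : Fin n) :
    alternatingSign (n + 1) k.succ = alternatingSign n k := by
  simp [alternatingSign]

lemma alternatingSign_zero (n : ℕ) : alternatingSign (n + 1) 0 = (-1) ^ (n + 1) := by
  simp [alternatingSign]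

/-- The values `C 𝔼 ‖fₙ‖² - 𝔼 ∑ ±q(dfₖ)`, for the martingales of length `n` which start at `x` and
for alternating signs. -/
def martingaleValues (q : E → ℝ) (C : ℝ) (n : ℕ) (x : E) : Set ℝ :=
  {c | ∃ f : Fin (n + 1) → (Fin n → ℤˣ) → E, IsWalshPaleyMartingale f ∧ (∀ ω, f 0 ω = x) ∧
    c = C * signExpectation (fun ω => ‖f (Fin.last n) ω‖ ^ 2) - signExpectation
      (fun ω => ∑ k : Fin n, ((alternatingSign n k : ℤ) : ℝ) * q (f k.succ ω - f k.castSucc ω))}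

lemma mem_martingaleValues_zero (q : E → ℝ) (C : ℝ) (x : E) :
    C * ‖x‖ ^ 2 ∈ martingaleValues q C 0 x :=
  ⟨fun _ _ => x, IsWalshPaleyMartingale.const_of_zero _, fun _ => rfl, by
    simp [signExpectation_fin_zero]⟩

open IsWalshPaleyMartingale in
-- Glue the two martingales by a first step `±d`. Counting signs from the end keeps the signs of the
-- old increments, and the new step contributes `q d` with sign `(-1) ^ (n + 1)`.
lemma average_mem_martingaleValues {q : E → ℝ} (hq : IsContQuadForm q) {C : ℝ} {n : ℕ} {x d : E}
    {c c' : ℝ} (hc : c ∈ martingaleValues q C n (x + d))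
    (hc' : c' ∈ martingaleValues q C n (x - d)) :
    (c + c') / 2 - (-1) ^ (n + 1) * q d ∈ martingaleValues q C (n + 1) x := by
  obtain ⟨f, hf, hfx, rfl⟩ := hc
  obtain ⟨f', hf', hfx', rfl⟩ := hc'
  set φ : ℤˣ → Fin (n + 1) → (Fin n → ℤˣ) → E := fun s => if s = 1 then f else f' with hφ
  have h1 : φ 1 = f := if_pos rfl
  have h2 : φ (-1) = f' := if_neg (by decide)
  have hφm : ∀ s, IsWalshPaleyMartingale (φ s) := by
    intro s
    rcases Int.units_eq_one_or s with rfl | rfl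
    · rwa [h1]
    · rwa [h2]
  have hneg : q (-d) = q d := by simpa using hq.map_smul (-1) d
  have hconst : ∀ a : ℝ, signExpectation (fun _ : Fin n → ℤˣ => a) = a := by
    intro a
    simp [signExpectation]
  refine ⟨glue x φ, isWalshPaleyMartingale_glue hφm (fun ω => by rw [h1, hfx])
    (fun ω => by rw [h2, hfx']), fun _ => rfl, ?_⟩
  simp only [signExpectation_fin_succ, Fin.sum_univ_succ, ← Fin.succ_last, glue_succ,
    ← Fin.succ_castSucc, Fin.castSucc_zero, glue_zero, Fin.cons_zero, Fin.tail_cons, h1, h2, hfx,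
    hfx', alternatingSign_succ, alternatingSign_zero, signExpectation_add, add_sub_cancel_left,
    sub_sub_cancel_left, hneg, hconst]
  push_cast
  ring

/-- A zero first step pads a martingale, so two martingales can be brought to a common length of
either parity. -/
lemma martingaleValues_subset_succ {q : E → ℝ} (hq : IsContQuadForm q) (C : ℝ) (n : ℕ) (x : E) :
    martingaleValues q C n x ⊆ martingaleValues q C (n + 1) x := by
  intro c hc
  have hq0 : q 0 = 0 := by simpa using hq.map_smul 0 0
  have h := average_mem_martingaleValues hq (x := x) (d := 0) (n := n) (C := C) (c := c) (c' := c)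
    (by rwa [add_zero]) (by rwa [sub_zero])
  rw [hq0] at h
  convert h using 1
  ring

theorem IsUMDSpace.hasQuadraticControl (hE : IsUMDSpace E) {q : E → ℝ} (hq : IsContQuadForm q) :
    HasQuadraticControl q := by
  obtain ⟨C, -, hC⟩ := hE.exists_signExpectation_le hq
  set S : E → Set ℝ := fun x => ⋃ n, martingaleValues q C n x with hS
  have h0 : ∀ x, ∀ c ∈ S x, 0 ≤ c := by
    rintro x c hc
    obtain ⟨n, f, hf, -, rfl⟩ := Set.mem_iUnion.1 hc
    exact sub_nonneg.2 (hC n f hf _)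
  have hbdd : ∀ x, BddBelow (S x) := fun x => ⟨0, fun c hc => h0 x c hc⟩
  have hmem : ∀ x, C * ‖x‖ ^ 2 ∈ S x :=
    fun x => Set.mem_iUnion.2 ⟨0, mem_martingaleValues_zero q C x⟩
  refine ⟨C, fun x => sInf (S x), fun x => Real.sInf_nonneg (h0 x),
    fun x => csInf_le (hbdd x) (hmem x), fun x d => ?_⟩
  refine le_of_forall_pos_le_add fun η hη => ?_
  obtain ⟨c, hc, hcη⟩ := exists_lt_of_csInf_lt ⟨_, hmem (x + d)⟩
    (lt_add_of_pos_right (sInf (S (x + d))) hη)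
  obtain ⟨c', hc', hcη'⟩ := exists_lt_of_csInf_lt ⟨_, hmem (x - d)⟩
    (lt_add_of_pos_right (sInf (S (x - d))) hη)
  obtain ⟨m, hm⟩ := Set.mem_iUnion.1 hc
  obtain ⟨m', hm'⟩ := Set.mem_iUnion.1 hc'
  have mono : ∀ x, Monotone fun n => martingaleValues q C n x :=
    fun x => monotone_nat_of_le_succ fun n => martingaleValues_subset_succ hq C n x
  have key : ∀ n, m + m' ≤ n → sInf (S x) ≤ (c + c') / 2 - (-1) ^ (n + 1) * q d := fun n hn =>
    csInf_le (hbdd x) (Set.mem_iUnion.2 ⟨n + 1, average_mem_martingaleValues hq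
      (mono _ (by omega) hm) (mono _ (by omega) hm')⟩)
  -- Lengths of opposite parity give `q d` both signs, hence `|q d|`.
  have k1 := key (2 * (m + m')) (by omega)
  have k2 := key (2 * (m + m') + 1) (by omega)
  rw [pow_succ, pow_mul] at k1
  rw [pow_succ, pow_succ, pow_mul] at k2
  norm_num at k1 k2
  rcases abs_cases (q d) with ⟨h, -⟩ | ⟨h, -⟩ <;> simp only [h] <;> linarith

end UMDToControl

/-! ### Property (D) and Hilbert spaces. -/

section Hilbert

variable {E : Type u} [NormedAddCommGroup E] [NormedSpace ℝ E]

lemma IsContQuadForm.add {p q : E → ℝ} (hp : IsContQuadForm p) (hq : IsContQuadForm q) :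
    IsContQuadForm fun x => p x + q x := by
  obtain ⟨b, hb⟩ := hp
  obtain ⟨c, hc⟩ := hq
  exact ⟨b + c, fun x => by simp [hb, hc]⟩

lemma IsContQuadForm.sub {p q : E → ℝ} (hp : IsContQuadForm p) (hq : IsContQuadForm q) :
    IsContQuadForm fun x => p x - q x := by
  obtain ⟨b, hb⟩ := hp
  obtain ⟨c, hc⟩ := hq
  exact ⟨b - c, fun x => by simp [hb, hc]⟩

lemma IsContQuadForm.const_mul {q : E → ℝ} (hq : IsContQuadForm q) (a : ℝ) :
    IsContQuadForm fun x => a * q x := by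
  obtain ⟨b, hb⟩ := hq
  exact ⟨a • b, fun x => by simp [hb]⟩

lemma isContQuadForm_norm_sq_comp {H : Type v} [NormedAddCommGroup H] [InnerProductSpace ℝ H]
    (T : E →L[ℝ] H) : IsContQuadForm fun x => ‖T x‖ ^ 2 :=
  ⟨(innerSL ℝ).bilinearComp T T, fun x => (real_inner_self_eq_norm_sq (T x)).symm⟩

/-- If a Hilbertian seminorm dominates the norm, then the space satisfies (D). -/
lemma propertyD_of_norm_sq_le {p : E → ℝ} (hp : IsContQuadForm p) (hle : ∀ x, ‖x‖ ^ 2 ≤ p x) :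
    PropertyD E := by
  intro q hq
  obtain ⟨K, hK0, hK⟩ := hq.exists_abs_le
  have h1 : ∀ x, |q x| ≤ K * p x :=
    fun x => (hK x).trans (mul_le_mul_of_nonneg_left (hle x) hK0)
  exact ⟨fun x => K * p x, fun x => K * p x - q x, hp.const_mul K, (hp.const_mul K).sub hq,
    fun x => (abs_nonneg _).trans (h1 x), fun x => sub_nonneg.2 ((le_abs_self _).trans (h1 x)),
    fun x => by ring⟩

/-- The Riesz isomorphism of a real Hilbert space, as a linear map. -/
def rieszMap (H : Type v) [NormedAddCommGroup H] [InnerProductSpace ℝ H] [CompleteSpace H] :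
    StrongDual ℝ H →L[ℝ] H :=
  LinearMap.mkContinuous
    { toFun := (InnerProductSpace.toDual ℝ H).symm
      map_add' := fun x y => map_add _ x y
      map_smul' := fun a x => by simp } 1 fun x => by simp

lemma norm_rieszMap {H : Type v} [NormedAddCommGroup H] [InnerProductSpace ℝ H] [CompleteSpace H]
    (φ : StrongDual ℝ H) : ‖rieszMap H φ‖ = ‖φ‖ :=
  (InnerProductSpace.toDual ℝ H).symm.norm_map φ

theorem IsIsomorphicToHilbert.propertyD_prod_strongDual (h : IsIsomorphicToHilbert E) :
    PropertyD (E × StrongDual ℝ E) := by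
  obtain ⟨H, _, _, _, ⟨e⟩⟩ := h
  set T₁ : E × StrongDual ℝ E →L[ℝ] H := (e : E →L[ℝ] H) ∘L ContinuousLinearMap.fst ℝ _ _
  -- Transport a functional to `H` by composing with `e.symm`, then apply Riesz.
  set T₂ : E × StrongDual ℝ E →L[ℝ] H := rieszMap H ∘L
    ((ContinuousLinearMap.compL ℝ H E ℝ).flip (e.symm : H →L[ℝ] E)) ∘L
      ContinuousLinearMap.snd ℝ _ _
  set A := ‖(e.symm : H →L[ℝ] E)‖
  set B := ‖(e : E →L[ℝ] H)‖
  have h₁ : ∀ z : E × StrongDual ℝ E, ‖z.1‖ ≤ A * ‖T₁ z‖ := by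
    intro z
    have h := (e.symm : H →L[ℝ] E).le_opNorm (e z.1)
    rwa [ContinuousLinearEquiv.coe_coe, e.symm_apply_apply] at h
  have h₂ : ∀ z : E × StrongDual ℝ E, ‖z.2‖ ≤ B * ‖T₂ z‖ := by
    intro z
    have h3 : ‖T₂ z‖ = ‖z.2 ∘L (e.symm : H →L[ℝ] E)‖ := norm_rieszMap _
    have h4 : z.2 = (z.2 ∘L (e.symm : H →L[ℝ] E)) ∘L (e : E →L[ℝ] H) := by
      ext x; simp
    rw [h3, mul_comm]
    conv_lhs => rw [h4]
    exact ContinuousLinearMap.opNorm_comp_le _ _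
  refine propertyD_of_norm_sq_le (((isContQuadForm_norm_sq_comp T₁).const_mul (A ^ 2)).add
    ((isContQuadForm_norm_sq_comp T₂).const_mul (B ^ 2))) fun z => ?_
  have h5 : ‖z.1‖ ^ 2 ≤ A ^ 2 * ‖T₁ z‖ ^ 2 := by
    rw [← mul_pow]; exact pow_le_pow_left₀ (norm_nonneg _) (h₁ z) 2
  have h6 : ‖z.2‖ ^ 2 ≤ B ^ 2 * ‖T₂ z‖ ^ 2 := by
    rw [← mul_pow]; exact pow_le_pow_left₀ (norm_nonneg _) (h₂ z) 2
  rw [Prod.norm_def]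
  rcases max_choice ‖z.1‖ ‖z.2‖ with h | h <;> rw [h]
  · linarith [sq_nonneg ‖z.2‖]
  · linarith [sq_nonneg ‖z.1‖]

/-- A nonnegative quadratic form satisfies the Cauchy-Schwarz inequality. -/
lemma abs_polar_le_of_nonneg {b : E →L[ℝ] E →L[ℝ] ℝ} (hb : ∀ x, 0 ≤ b x x) (x y : E) :
    (b x y + b y x) ^ 2 ≤ 4 * b x x * b y y := by
  have h : ∀ t : ℝ, 0 ≤ b y y * (t * t) + (b x y + b y x) * t + b x x := by
    intro t
    have := hb (x + t • y)
    simp only [map_add, map_smul, add_apply, smul_apply, smul_eq_mul] at this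
    linarith
  have := discrim_le_zero h
  rw [discrim] at this
  linarith

/-- A copy of a vector space, to carry another norm. -/
def RenormedCopy (E : Type u) : Type u := E

instance : AddCommGroup (RenormedCopy E) := inferInstanceAs (AddCommGroup E)

instance : Module ℝ (RenormedCopy E) := inferInstanceAs (Module ℝ E)

/-- The symmetrized bilinear form of `p` is an inner product whose norm is equivalent to the given
one, so completeness carries over. -/
theorem isIsomorphicToHilbert_of_norm_sq_le [CompleteSpace E] {p : E → ℝ} (hp : IsContQuadForm p)
    (hp0 : ∀ x, 0 ≤ p x) {c : ℝ} (hle : ∀ x, ‖x‖ ^ 2 ≤ c * p x) : IsIsomorphicToHilbert E := by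
  obtain ⟨K, hK0, hK⟩ := hp.exists_abs_le
  obtain ⟨b, hb⟩ := hp
  let e : E ≃ₗ[ℝ] RenormedCopy E := LinearEquiv.refl ℝ E
  let core : InnerProductSpace.Core ℝ (RenormedCopy E) :=
    { inner := fun x y => (b (e.symm x) (e.symm y) + b (e.symm y) (e.symm x)) / 2
      conj_inner_symm := fun x y => by
        simp only [conj_trivial]; ring
      re_inner_nonneg := fun x => by
        have := hp0 (e.symm x)
        rw [hb] at this
        simpa using this
      add_left := fun x y z => by
        simp only [map_add, add_apply]; ring
      smul_left := fun x y r => by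
        simp only [map_smul, smul_apply, smul_eq_mul, conj_trivial]; ring
      definite := fun x hx => by
        have h1 : p (e.symm x) = 0 := by rw [hb]; linarith
        have h2 := hle (e.symm x)
        rw [h1, mul_zero] at h2
        have h3 := pow_eq_zero_iff two_ne_zero |>.1 (le_antisymm h2 (sq_nonneg _))
        exact e.symm.map_eq_zero_iff.1 (norm_eq_zero.1 h3) }
  let : NormedAddCommGroup (RenormedCopy E) := core.toNormedAddCommGroup
  let : InnerProductSpace ℝ (RenormedCopy E) := InnerProductSpace.ofCore core.toCore
  have hn : ∀ x : E, ‖e x‖ ^ 2 = p x := by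
    intro x
    rw [← real_inner_self_eq_norm_sq, hb]
    change (b (e.symm (e x)) (e.symm (e x)) + b (e.symm (e x)) (e.symm (e x))) / 2 = _
    rw [e.symm_apply_apply]
    ring
  let e' : E ≃L[ℝ] RenormedCopy E := e.toContinuousLinearEquivOfBounds √K √c
    (fun x => by
      rw [← Real.sqrt_sq (norm_nonneg (e x)), ← Real.sqrt_sq (norm_nonneg x), ← Real.sqrt_mul hK0]
      refine Real.sqrt_le_sqrt ?_
      rw [hn]
      exact (le_abs_self _).trans (hK x))
    (fun y => by
      obtain ⟨x, rfl⟩ := e.surjective y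
      rw [e.symm_apply_apply, ← Real.sqrt_sq (norm_nonneg (e x)), ← Real.sqrt_sq (norm_nonneg x),
        ← Real.sqrt_mul' _ (sq_nonneg _)]
      refine Real.sqrt_le_sqrt ?_
      rw [hn]
      exact hle x)
  exact ⟨RenormedCopy E, _, _, (completeSpace_congr (e := e'.toEquiv) e'.isUniformEmbedding).1 inferInstance, ⟨e'⟩⟩

theorem IsDeltaSemidefinite.isIsomorphicToHilbert [CompleteSpace E]
    (h : IsDeltaSemidefinite (pairingForm E)) : IsIsomorphicToHilbert E := by
  obtain ⟨p₁, p₂, ⟨b₁, hb₁⟩, ⟨b₂, hb₂⟩, h₁, h₂, h⟩ := h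
  set ι : E →L[ℝ] E × StrongDual ℝ E := ContinuousLinearMap.inl ℝ _ _
  set κ : StrongDual ℝ E →L[ℝ] E × StrongDual ℝ E := ContinuousLinearMap.inr ℝ _ _
  set p : E → ℝ := fun x => p₁ (ι x) + p₂ (ι x) with hp
  have hpq : IsContQuadForm p :=
    IsContQuadForm.add ⟨b₁.bilinearComp ι ι, fun x => hb₁ _⟩ ⟨b₂.bilinearComp ι ι, fun x => hb₂ _⟩
  have hp0 : ∀ x, 0 ≤ p x := fun x => add_nonneg (h₁ _) (h₂ _)
  obtain ⟨K₁, hK₁, hq₁⟩ := IsContQuadForm.exists_abs_le ⟨b₁, hb₁⟩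
  obtain ⟨K₂, hK₂, hq₂⟩ := IsContQuadForm.exists_abs_le ⟨b₂, hb₂⟩
  refine isIsomorphicToHilbert_of_norm_sq_le (c := 8 * (K₁ + K₂)) hpq hp0 fun x => ?_
  obtain ⟨φ, hφ1, hφ2⟩ := exists_dual_norm_le_and_apply_eq x
  have hκ : ‖κ φ‖ ≤ ‖x‖ := by simpa [κ] using hφ1
  have c₁ := abs_polar_le_of_nonneg (fun z => (hb₁ z) ▸ h₁ z) (ι x) (κ φ)
  have c₂ := abs_polar_le_of_nonneg (fun z => (hb₂ z) ▸ h₂ z) (ι x) (κ φ)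
  have k₁ : b₁ (κ φ) (κ φ) ≤ K₁ * ‖x‖ ^ 2 := by
    rw [← hb₁]
    refine (le_abs_self _).trans ((hq₁ _).trans ?_)
    gcongr
  have k₂ : b₂ (κ φ) (κ φ) ≤ K₂ * ‖x‖ ^ 2 := by
    rw [← hb₂]
    refine (le_abs_self _).trans ((hq₂ _).trans ?_)
    gcongr
  -- `Q` vanishes on both summands, so its polar form at `(x, 0)` and `(0, φ)` is `φ x = ‖x‖²`.
  have hpol : ‖x‖ ^ 2 = (b₁ (ι x) (κ φ) + b₁ (κ φ) (ι x))
      - (b₂ (ι x) (κ φ) + b₂ (κ φ) (ι x)) := by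
    have e1 := h (ι x + κ φ)
    have e2 := h (ι x)
    have e3 := h (κ φ)
    have e4 : pairingForm E (ι x + κ φ) = ‖x‖ ^ 2 := by simpa [pairingForm, ι, κ] using hφ2
    have e5 : pairingForm E (ι x) = 0 := by simp [pairingForm, ι]
    have e6 : pairingForm E (κ φ) = 0 := by simp [pairingForm, κ]
    rw [e4, hb₁, hb₂] at e1
    rw [e5, hb₁, hb₂] at e2
    rw [e6, hb₁, hb₂] at e3
    simp only [map_add, add_apply] at e1
    linarith
  have n₁ : 0 ≤ b₁ (ι x) (ι x) := hb₁ (ι x) ▸ h₁ _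
  have n₂ : 0 ≤ b₂ (ι x) (ι x) := hb₂ (ι x) ▸ h₂ _
  have m₁ := mul_le_mul_of_nonneg_left k₁ (mul_nonneg zero_le_four n₁)
  have m₂ := mul_le_mul_of_nonneg_left k₂ (mul_nonneg zero_le_four n₂)
  have hpx : p x = b₁ (ι x) (ι x) + b₂ (ι x) (ι x) := by rw [hp, ← hb₁, ← hb₂]
  -- The 8 is the 2 of `(a - b)² ≤ 2a² + 2b²` times the 4 of Cauchy-Schwarz.
  have hsq : (‖x‖ ^ 2) ^ 2 ≤ 8 * (K₁ + K₂) * p x * ‖x‖ ^ 2 := by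
    have s : (‖x‖ ^ 2) ^ 2 ≤ 2 * (b₁ (ι x) (κ φ) + b₁ (κ φ) (ι x)) ^ 2
        + 2 * (b₂ (ι x) (κ φ) + b₂ (κ φ) (ι x)) ^ 2 := by
      rw [hpol]
      nlinarith [sq_nonneg ((b₁ (ι x) (κ φ) + b₁ (κ φ) (ι x))
        + (b₂ (ι x) (κ φ) + b₂ (κ φ) (ι x)))]
    have t₁ := mul_nonneg (mul_nonneg hK₁ n₂) (sq_nonneg ‖x‖)
    have t₂ := mul_nonneg (mul_nonneg hK₂ n₁) (sq_nonneg ‖x‖)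
    rw [hpx]
    nlinarith
  rcases (sq_nonneg ‖x‖).eq_or_lt with h0 | h0
  · rw [← h0]
    exact mul_nonneg (by positivity) (hp0 x)
  · rw [sq (‖x‖ ^ 2)] at hsq
    exact le_of_mul_le_mul_right hsq h0

end Hilbert

end

theorem proposition3p8 (X : Type*) [NormedAddCommGroup X] [NormedSpace ℝ X] [CompleteSpace X] :
    IsContQuadForm (pairingForm X) ∧
    List.TFAE [PropertyD (X × StrongDual ℝ X),
      IsDeltaSemidefinite (pairingForm X),
      IsIsomorphicToHilbert X] ∧
    List.TFAE [PropertyDC (X × StrongDual ℝ X),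
      IsDeltaConvex (pairingForm X),
      IsUMDSpace X] := by
  refine ⟨isContQuadForm_pairingForm, ?_, ?_⟩
  · tfae_have 1 → 2 := fun h => h _ isContQuadForm_pairingForm
    tfae_have 2 → 3 := fun h => h.isIsomorphicToHilbert
    tfae_have 3 → 1 := fun h => h.propertyD_prod_strongDual
    tfae_finish
  · tfae_have 1 → 2 := fun h => h _ isContQuadForm_pairingForm
    tfae_have 2 → 3 := fun h => isUMDSpace_of_hasQuadraticControl_pairingForm
      (h.hasQuadraticControl isContQuadForm_pairingForm)
    tfae_have 3 → 1 := fun h q hq =>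
      ((h.prod h.strongDual).hasQuadraticControl hq).isDeltaConvex hq
    tfae_finish
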